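/- Let $n\ge 0$ be an integer. For a tuple $\alpha=(\alpha_{i,j,k})_{0\le i,j,k\le n}$ of rational numbers put \[ F(x,y,z)=\sum_{0\le i,j,k\le n}\alpha_{i,j,k}\,x_iy_jz_k , \] and let $V=V_\alpha\subset \mathbf P^n_{\mathbf Q}\times\mathbf P^n_{\mathbf Q}\times\mathbf P^n_{\mathbf Q}$ be the closed subscheme $F=0$. Define the complex affine algebraic sets \[ V_1^*=\Big\{(y,z)\in\mathbf C^{n+1}\times\mathbf C^{n+1} : \sum_{j,k}\alpha_{i,j,k}y_jz_k=0 \text{ for all } 0\le i\le n\Big\}, \] \[ V_2^*=\Big\{(x,z)\in\mathbf C^{n+1}\times\mathbf C^{n+1} : \sum_{i,k}\alpha_{i,j,k}x_iz_k=0 \text{ for all } 0\le j\le n\Big\}, \] \[ V_3^*=\Big\{(x,y)\in\mathbf C^{n+1}\times\mathbf C^{n+1} : \sum_{i,j}\alpha_{i,j,k}x_iy_j=0 \text{ for all } 0\le k\le n\Big\}. \] Then there is a dense Zariski open subset $U$ of the affine space $\mathbf A_{\mathbf Q}^{(n+1)^3}$ of coefficient tuples such that, for every rational tuple $\alpha=(\alpha_{i,j,k})\in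 U$, the hypersurface $V$ is smooth over $\mathbf Q$ and \[ \dim V_1^*=\dim V_2^*=\dim V_3^*=n+1 . \] -/

import Mathlib

open MvPolynomial

/-- Index set of the coefficient tuples `(α i j k)`, `0 ≤ i, j, k ≤ n`. -/
abbrev CoeffIdx (n : ℕ) : Type := Fin (n + 1) × Fin (n + 1) × Fin (n + 1)

/-- Index set of the `3 (n + 1)` coordinates: the `x i` (left), the `y j` (middle) and the
`z k` (right). -/
abbrev CoordIdx (n : ℕ) : Type := Fin (n + 1) ⊕ Fin (n + 1) ⊕ Fin (n + 1)

/-- The coordinate `x i`. -/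
noncomputable def coordX {n : ℕ} (i : Fin (n + 1)) : MvPolynomial (CoordIdx n) ℚ :=
  X (Sum.inl i)

/-- The coordinate `y j`. -/
noncomputable def coordY {n : ℕ} (j : Fin (n + 1)) : MvPolynomial (CoordIdx n) ℚ :=
  X (Sum.inr (Sum.inl j))

/-- The coordinate `z k`. -/
noncomputable def coordZ {n : ℕ} (k : Fin (n + 1)) : MvPolynomial (CoordIdx n) ℚ :=
  X (Sum.inr (Sum.inr k))

/-- The trilinear form `F(x, y, z) = ∑ α i j k * x i * y j * z k`. -/
noncomputable def trilinearForm {n : ℕ} (α : CoeffIdx n → ℚ) : MvPolynomial (CoordIdx n) ℚ :=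
  ∑ i, ∑ j, ∑ k, C (α (i, j, k)) * coordX i * coordY j * coordZ k

/-- The ideal `(F, x a - 1, y b - 1, z c - 1)`. -/
noncomputable def chartIdeal {n : ℕ} (α : CoeffIdx n → ℚ) (a b c : Fin (n + 1)) :
    Ideal (MvPolynomial (CoordIdx n) ℚ) :=
  Ideal.span {trilinearForm α, coordX a - 1, coordY b - 1, coordZ c - 1}

/-- The coordinate ring of the affine open subscheme `{x a ≠ 0, y b ≠ 0, z c ≠ 0}` of the
hypersurface `V = {F = 0}` of `ℙⁿ × ℙⁿ × ℙⁿ` over `ℚ`: on the standard affine chart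
`x a = y b = z c = 1` of the triprojective space, `V` is cut out by the dehomogenized `F`. -/
abbrev ChartRing {n : ℕ} (α : CoeffIdx n → ℚ) (a b c : Fin (n + 1)) : Type :=
  MvPolynomial (CoordIdx n) ℚ ⧸ chartIdeal α a b c

/-- The hypersurface `V` is smooth over `ℚ`: every member of its standard affine open cover,
the spectrum of `ChartRing α a b c`, is smooth over `ℚ`. -/
def IsSmoothHypersurface {n : ℕ} (α : CoeffIdx n → ℚ) : Prop :=
  ∀ a b c : Fin (n + 1), Algebra.Smooth ℚ (ChartRing α a b c)

/-- `B k (x, y) = ∑ i j, α i j k * x i * y j`. -/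
def bilinB {n : ℕ} (α : CoeffIdx n → ℚ) (k : Fin (n + 1)) (x y : Fin (n + 1) → ℂ) : ℂ :=
  ∑ i, ∑ j, (α (i, j, k) : ℂ) * x i * y j

/-- `B' j (x, z) = ∑ i k, α i j k * x i * z k`. -/
def bilinB' {n : ℕ} (α : CoeffIdx n → ℚ) (j : Fin (n + 1)) (x z : Fin (n + 1) → ℂ) : ℂ :=
  ∑ i, ∑ k, (α (i, j, k) : ℂ) * x i * z k

/-- `B'' i (y, z) = ∑ j k, α i j k * y j * z k`. -/
def bilinB'' {n : ℕ} (α : CoeffIdx n → ℚ) (i : Fin (n + 1)) (y z : Fin (n + 1) → ℂ) : ℂ :=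
  ∑ j, ∑ k, (α (i, j, k) : ℂ) * y j * z k

/-- Complex points of `𝔸ⁿ⁺¹ × 𝔸ⁿ⁺¹`: the first factor is read off at `Sum.inl`, the second one
at `Sum.inr`. -/
abbrev BiAffine (n : ℕ) : Type := Fin (n + 1) ⊕ Fin (n + 1) → ℂ

/-- `V₁* = {(y, z) | B'' i (y, z) = 0 for all i}`. -/
def V1star {n : ℕ} (α : CoeffIdx n → ℚ) : Set (BiAffine n) :=
  {p | ∀ i, bilinB'' α i (p ∘ Sum.inl) (p ∘ Sum.inr) = 0}

/-- `V₂* = {(x, z) | B' j (x, z) = 0 for all j}`. -/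
def V2star {n : ℕ} (α : CoeffIdx n → ℚ) : Set (BiAffine n) :=
  {p | ∀ j, bilinB' α j (p ∘ Sum.inl) (p ∘ Sum.inr) = 0}

/-- `V₃* = {(x, y) | B k (x, y) = 0 for all k}`. -/
def V3star {n : ℕ} (α : CoeffIdx n → ℚ) : Set (BiAffine n) :=
  {p | ∀ k, bilinB α k (p ∘ Sum.inl) (p ∘ Sum.inr) = 0}

/-- The dimension of an algebraic subset of a complex affine space: the Krull dimension of its
coordinate ring (polynomials modulo those vanishing on the set). -/
noncomputable def algSetDim {σ : Type} (S : Set (σ → ℂ)) : WithBot ℕ∞ :=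
  ringKrullDim (MvPolynomial σ ℂ ⧸ vanishingIdeal ℂ S)

/-! Each required property holds off the zero locus of a nonzero polynomial in the coefficients, and
`U` is the basic open set of the product of these polynomials.

Dimension: `V1star` contains the linear space `y = 0`, so its dimension is at least `n + 1`. For the
upper bound, restrict the equations to the diagonal `y = z`. If the resulting quadrics have nonzero
Macaulay determinant, every monomial of degree `n + 2` in `y` lies in the ideal they generate. This
makes the coordinate ring integral over the polynomial ring in the `n + 1` differences `y k - z k`
(`isIntegral_of_macaulayDet_ne_zero`). The other two sets follow by permuting indices.

Smoothness: this is a Bertini-type dimension count. On a chart, the pairs (coefficients, singular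
point) are parametrized by fewer than `(n + 1) ^ 3` quantities, so the coefficients satisfy a
nontrivial relation `P` (`exists_relation_universalSingularIdeal`). Where `P` does not vanish, the
singular ideal is the unit ideal and the Jacobian criterion applies. -/

theorem ringKrullDim_le_of_isIntegral {R A : Type*} [CommRing R] [CommRing A] [Algebra R A]
    [Algebra.IsIntegral R A] : ringKrullDim A ≤ ringKrullDim R := by
  refine Order.krullDim_le_of_strictMono
    (fun p : PrimeSpectrum A => PrimeSpectrum.comap (algebraMap R A) p) ?_
  intro p q hpq
  obtain ⟨x, hxq, hxp⟩ := SetLike.exists_of_lt (show p.asIdeal < q.asIdeal from hpq)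
  exact Ideal.comap_lt_comap_of_integral_mem_sdiff (le_of_lt hpq) ⟨hxq, hxp⟩
    (Algebra.IsIntegral.isIntegral x)

/-! ### Integrality from rewriting monomials of top degree. -/

section Monomials

variable {ι A : Type*} [Fintype ι] [CommRing A]

/-- The monomial `∏ i, y i ^ w i`. -/
def evalMonomial (y : ι → A) (w : ι → ℕ) : A := ∏ i, y i ^ w i

theorem evalMonomial_zero (y : ι → A) : evalMonomial y 0 = 1 := by simp [evalMonomial]

theorem evalMonomial_add (y : ι → A) (u w : ι → ℕ) :
    evalMonomial y (u + w) = evalMonomial y u * evalMonomial y w := by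
  simp [evalMonomial, pow_add, Finset.prod_mul_distrib]

theorem evalMonomial_single [DecidableEq ι] (y : ι → A) (i : ι) :
    evalMonomial y (Pi.single i 1) = y i := by
  rw [evalMonomial, Finset.prod_eq_single i] <;> simp +contextual

/-- The hypothesis makes the span of the monomials of degree at most `d` stable under each `y j`. It
is therefore the whole subalgebra generated by `y`, which is then a finite module. -/
theorem isIntegral_of_evalMonomial_mem_span [DecidableEq ι] {R : Type*} [CommRing R] [Algebra R A]
    (y : ι → A) (d : ℕ)
    (h : ∀ w : ι → ℕ, ∑ i, w i = d + 1 →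
      evalMonomial y w ∈ Submodule.span R (evalMonomial y '' {u | ∑ i, u i ≤ d})) (i : ι) :
    IsIntegral R (y i) := by
  set N := Submodule.span R (evalMonomial y '' {u | ∑ i, u i ≤ d}) with hN
  have hfin : ({u : ι → ℕ | ∑ i, u i ≤ d}).Finite := by
    refine (Set.finite_Iic (fun _ : ι => d)).subset fun u hu j => ?_
    exact (Finset.single_le_sum (fun _ _ => Nat.zero_le _) (Finset.mem_univ j)).trans hu
  have hFG : N.FG := Submodule.fg_span (hfin.image _)
  have hone : (1 : A) ∈ N :=
    Submodule.subset_span ⟨0, by simp, evalMonomial_zero y⟩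
  have hmul : ∀ j, ∀ x ∈ N, y j * x ∈ N := by
    intro j x hx
    induction hx using Submodule.span_induction with
    | mem x hx =>
      obtain ⟨u, hu, rfl⟩ := hx
      rw [← evalMonomial_single y j, ← evalMonomial_add]
      have hs : ∑ i, (Pi.single j 1 + u : ι → ℕ) i = 1 + ∑ i, u i := by
        simp [Finset.sum_add_distrib]
      rcases (show ∑ i, u i ≤ d from hu).lt_or_eq with hlt | heq
      · exact Submodule.subset_span ⟨_, by rw [Set.mem_ofPred_eq, hs]; omega, rfl⟩
      · exact h _ (by omega)
    | zero => simp
    | add x x' _ _ hx hx' => rw [mul_add]; exact N.add_mem hx hx'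
    | smul r x _ hx => rw [mul_smul_comm]; exact N.smul_mem r hx
  have hS : ∀ x ∈ Algebra.adjoin R (Set.range y), ∀ v ∈ N, x * v ∈ N := by
    intro x hx
    induction hx using Algebra.adjoin_induction with
    | mem x hx => obtain ⟨j, rfl⟩ := hx; exact hmul j
    | algebraMap r => intro v hv; rw [← Algebra.smul_def]; exact N.smul_mem r hv
    | add x x' _ _ hx hx' => intro v hv; rw [add_mul]; exact N.add_mem (hx v hv) (hx' v hv)
    | mul x x' _ _ hx hx' => intro v hv; rw [mul_assoc]; exact hx _ (hx' v hv)
  have hle : Subalgebra.toSubmodule (Algebra.adjoin R (Set.range y)) = N := by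
    refine le_antisymm (fun x hx => by simpa using hS x hx 1 hone) (Submodule.span_le.2 ?_)
    rintro _ ⟨u, -, rfl⟩
    exact Subalgebra.prod_mem _ fun j _ =>
      Subalgebra.pow_mem _ (Algebra.subset_adjoin (Set.mem_range_self j)) _
  exact IsIntegral.of_mem_of_fg _ (hle ▸ hFG) _ (Algebra.subset_adjoin (Set.mem_range_self i))

end Monomials

/-! ### Macaulay matrices of quadrics. -/

section Macaulay

variable {n : ℕ}

/-- Exponent vectors of degree `n + 2` in `n + 1` variables. -/
abbrev MacaulayIdx (n : ℕ) : Type :=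
  ↥(Finset.piAntidiag (Finset.univ : Finset (Fin (n + 1))) (n + 2))

theorem MacaulayIdx.sum_eq (m : MacaulayIdx n) : ∑ i, m.1 i = n + 2 :=
  (Finset.mem_piAntidiag.1 m.2).1

/-- Pigeonhole: this is why the degree is `n + 2`, one more than the number of variables. -/
theorem MacaulayIdx.exists_two_le (m : MacaulayIdx n) : ∃ i, 2 ≤ m.1 i := by
  by_contra! hcon
  have h : ∑ i, m.1 i ≤ ∑ _i : Fin (n + 1), 1 :=
    Finset.sum_le_sum fun i _ => Nat.le_of_lt_succ (hcon i)
  rw [m.sum_eq] at h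
  simp at h

/-- A variable whose square divides the given monomial. -/
noncomputable def MacaulayIdx.pivot (m : MacaulayIdx n) : Fin (n + 1) := m.exists_two_le.choose

/-- The given monomial divided by the square of its pivot. -/
noncomputable def MacaulayIdx.cofactor (m : MacaulayIdx n) : Fin (n + 1) → ℕ :=
  m.1 - Pi.single m.pivot 2

theorem MacaulayIdx.cofactor_add (m : MacaulayIdx n) :
    m.cofactor + Pi.single m.pivot 1 + Pi.single m.pivot 1 = m.1 := by
  have h : 2 ≤ m.1 m.pivot := m.exists_two_le.choose_spec
  ext j
  by_cases hj : j = m.pivot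
  · subst hj; simp [cofactor]; omega
  · simp [cofactor, hj]

theorem MacaulayIdx.sum_cofactor (m : MacaulayIdx n) : ∑ i, m.cofactor i = n := by
  have h := m.sum_eq
  rw [← m.cofactor_add] at h
  simp [Finset.sum_add_distrib] at h
  exact h

/-- The Macaulay matrix of the quadrics `∑ β i j k * y j * y k` in degree `n + 2`. -/
noncomputable def macaulayMatrix {S : Type*} [CommRing S] (β : CoeffIdx n → S) :
    Matrix (MacaulayIdx n) (MacaulayIdx n) S :=
  fun m w => ∑ j, ∑ k,
    if m.cofactor + Pi.single j 1 + Pi.single k 1 = w.1 then β (m.pivot, j, k) else 0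

theorem map_macaulayMatrix {S T : Type*} [CommRing S] [CommRing T] (f : S →+* T)
    (β : CoeffIdx n → S) : (macaulayMatrix β).map f = macaulayMatrix (f ∘ β) := by
  ext m w
  simp [macaulayMatrix, apply_ite f]

/-- For the quadrics `y i ^ 2`, cofactor times quadric gives back the original monomial. This
specialization shows that the generic determinant is nonzero. -/
theorem macaulayMatrix_diagonal {S : Type*} [CommRing S] :
    macaulayMatrix (n := n) (fun t => if t.1 = t.2.1 ∧ t.1 = t.2.2 then (1 : S) else 0) = 1 := by
  ext m w
  rw [macaulayMatrix, Finset.sum_eq_single m.pivot, Finset.sum_eq_single m.pivot]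
  · rw [m.cofactor_add, Matrix.one_apply]
    simp only [Subtype.ext_iff, and_self, if_true]
  · intro k _ hk; simp [hk.symm]
  · simp
  · intro j _ hj; simp [hj.symm]
  · simp

theorem macaulayMatrix_mulVec {A : Type*} [CommRing A] (β : CoeffIdx n → A) (y : Fin (n + 1) → A)
    (m : MacaulayIdx n) :
    ∑ w : MacaulayIdx n, macaulayMatrix β m w * evalMonomial y w.1 =
      evalMonomial y m.cofactor * ∑ j, ∑ k, β (m.pivot, j, k) * y j * y k := by
  simp only [macaulayMatrix, Finset.sum_mul, Finset.mul_sum]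
  rw [Finset.sum_comm]
  refine Finset.sum_congr rfl fun j _ => ?_
  rw [Finset.sum_comm]
  refine Finset.sum_congr rfl fun k _ => ?_
  have hs : ∑ i, (m.cofactor + Pi.single j 1 + Pi.single k 1 : Fin (n + 1) → ℕ) i = n + 2 := by
    simp [Finset.sum_add_distrib, m.sum_cofactor]
  rw [Finset.sum_eq_single ⟨_, Finset.mem_piAntidiag.2 ⟨hs, by simp⟩⟩]
  · simp only [if_true, evalMonomial_add, evalMonomial_single]
    ring
  · intro w _ hw
    rw [if_neg fun h => hw (Subtype.ext h.symm), zero_mul]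
  · simp

/-- The determinant of the generic Macaulay matrix. -/
noncomputable def macaulayDet (n : ℕ) : MvPolynomial (CoeffIdx n) ℚ :=
  (macaulayMatrix X).det

theorem eval_macaulayDet (β : CoeffIdx n → ℚ) :
    eval β (macaulayDet n) = (macaulayMatrix β).det := by
  rw [macaulayDet, RingHom.map_det, RingHom.mapMatrix_apply, map_macaulayMatrix]
  congr 2
  ext t
  simp

theorem macaulayDet_ne_zero (n : ℕ) : macaulayDet n ≠ 0 := by
  intro h
  have := eval_macaulayDet (n := n) (fun t => if t.1 = t.2.1 ∧ t.1 = t.2.2 then 1 else 0)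
  rw [macaulayMatrix_diagonal, h] at this
  simp at this

variable {R A : Type*} [CommRing R] [CommRing A] [Algebra ℚ R] [Algebra ℚ A] [Algebra R A]
  [IsScalarTower ℚ R A]

/-- Inverting the matrix writes the monomial as a rational combination of cofactor times quadric. In
each quadric the bilinear relation lets one factor `y k` be replaced by the scalar `t k`, which
lowers the degree in `y` to `n + 1`. -/
theorem evalMonomial_mem_span_of_macaulayDet_ne_zero {β : CoeffIdx n → ℚ}
    (hβ : eval β (macaulayDet n) ≠ 0) (y z : Fin (n + 1) → A)
    (hyz : ∀ i, ∑ j, ∑ k, algebraMap ℚ A (β (i, j, k)) * y j * z k = 0)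
    (t : Fin (n + 1) → R) (ht : ∀ k, algebraMap R A (t k) = y k - z k)
    (w : Fin (n + 1) → ℕ) (hw : ∑ i, w i = n + 2) :
    evalMonomial y w ∈ Submodule.span R (evalMonomial y '' {u | ∑ i, u i ≤ n + 1}) := by
  set N := Submodule.span R (evalMonomial y '' {u : Fin (n + 1) → ℕ | ∑ i, u i ≤ n + 1})
  have hdet : IsUnit (macaulayMatrix β).det := by
    rw [← eval_macaulayDet]; exact hβ.isUnit
  have hinv : ((macaulayMatrix β)⁻¹.map (algebraMap ℚ A)) *
      macaulayMatrix (algebraMap ℚ A ∘ β) = 1 := by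
    rw [← map_macaulayMatrix, ← Matrix.map_mul, Matrix.nonsing_inv_mul _ hdet]
    simp
  have hvec : (macaulayMatrix (algebraMap ℚ A ∘ β)).mulVec
      (fun w : MacaulayIdx n => evalMonomial y w.1) = fun m => evalMonomial y m.cofactor *
        ∑ j, ∑ k, algebraMap ℚ A (β (m.pivot, j, k)) * y j * y k :=
    funext fun m => macaulayMatrix_mulVec (algebraMap ℚ A ∘ β) y m
  have hrow : ∀ m : MacaulayIdx n, evalMonomial y m.cofactor *
      ∑ j, ∑ k, algebraMap ℚ A (β (m.pivot, j, k)) * y j * y k ∈ N := by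
    intro m
    have hsub : ∑ j, ∑ k, algebraMap ℚ A (β (m.pivot, j, k)) * y j * y k =
        ∑ j, ∑ k, algebraMap ℚ A (β (m.pivot, j, k)) * y j * algebraMap R A (t k) := by
      rw [← sub_zero (∑ j, ∑ k, algebraMap ℚ A (β (m.pivot, j, k)) * y j * y k), ← hyz m.pivot]
      simp only [ht, mul_sub, Finset.sum_sub_distrib]
    rw [hsub, Finset.mul_sum]
    refine N.sum_mem fun j _ => ?_
    rw [Finset.mul_sum]
    refine N.sum_mem fun k _ => ?_
    have : evalMonomial y m.cofactor *
        (algebraMap ℚ A (β (m.pivot, j, k)) * y j * algebraMap R A (t k)) =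
        (algebraMap ℚ R (β (m.pivot, j, k)) * t k) •
          evalMonomial y (m.cofactor + Pi.single j 1) := by
      rw [Algebra.smul_def, map_mul, ← IsScalarTower.algebraMap_apply, evalMonomial_add,
        evalMonomial_single]
      ring
    rw [this]
    refine N.smul_mem _ (Submodule.subset_span ⟨_, ?_, rfl⟩)
    simp [Finset.sum_add_distrib, m.sum_cofactor]
  have hmem : w ∈ Finset.piAntidiag (Finset.univ : Finset (Fin (n + 1))) (n + 2) :=
    Finset.mem_piAntidiag.2 ⟨hw, by simp⟩
  have hsolve : evalMonomial y w = ∑ m : MacaulayIdx n,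
      algebraMap ℚ A ((macaulayMatrix β)⁻¹ ⟨w, hmem⟩ m) * (evalMonomial y m.cofactor *
        ∑ j, ∑ k, algebraMap ℚ A (β (m.pivot, j, k)) * y j * y k) := by
    have := congrFun (congrArg ((macaulayMatrix β)⁻¹.map (algebraMap ℚ A)).mulVec hvec) ⟨w, hmem⟩
    rw [Matrix.mulVec_mulVec, hinv, Matrix.one_mulVec] at this
    exact this
  rw [hsolve]
  refine N.sum_mem fun m _ => ?_
  rw [IsScalarTower.algebraMap_apply ℚ R A, ← Algebra.smul_def]
  exact N.smul_mem _ (hrow m)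

theorem isIntegral_of_macaulayDet_ne_zero {β : CoeffIdx n → ℚ}
    (hβ : eval β (macaulayDet n) ≠ 0) (y z : Fin (n + 1) → A)
    (hyz : ∀ i, ∑ j, ∑ k, algebraMap ℚ A (β (i, j, k)) * y j * z k = 0)
    (t : Fin (n + 1) → R) (ht : ∀ k, algebraMap R A (t k) = y k - z k) (i : Fin (n + 1)) :
    IsIntegral R (y i) ∧ IsIntegral R (z i) := by
  have hy : IsIntegral R (y i) := isIntegral_of_evalMonomial_mem_span y (n + 1)
    (evalMonomial_mem_span_of_macaulayDet_ne_zero hβ y z hyz t ht) i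
  refine ⟨hy, ?_⟩
  rw [show z i = y i - algebraMap R A (t i) by rw [ht]; ring]
  exact hy.sub isIntegral_algebraMap

end Macaulay

/-! ### Dimension of the bilinear zero loci. -/

section Dimension

variable {n : ℕ}

theorem ringKrullDim_le_of_macaulayDet_ne_zero {K A : Type*} [Field K] [Algebra ℚ K] [CommRing A]
    [Algebra K A] [Algebra ℚ A] {β : CoeffIdx n → ℚ} (hβ : eval β (macaulayDet n) ≠ 0)
    (y z : Fin (n + 1) → A)
    (hyz : ∀ i, ∑ j, ∑ k, algebraMap ℚ A (β (i, j, k)) * y j * z k = 0)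
    (hgen : Function.Surjective (aeval (R := K) (Sum.elim y z))) :
    ringKrullDim A ≤ ((n + 1 : ℕ) : WithBot ℕ∞) := by
  let f : MvPolynomial (Fin (n + 1)) K →ₐ[K] A := aeval fun k => y k - z k
  let _ : Algebra (MvPolynomial (Fin (n + 1)) K) A := f.toRingHom.toAlgebra
  have hf : ∀ p, algebraMap (MvPolynomial (Fin (n + 1)) K) A p = f p := fun _ => rfl
  -- Ring homomorphisms out of `ℚ` are unique, so the given `ℚ`-structure is compatible.
  have : IsScalarTower ℚ (MvPolynomial (Fin (n + 1)) K) A :=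
    IsScalarTower.of_algebraMap_eq' (Subsingleton.elim _ _)
  have hint := isIntegral_of_macaulayDet_ne_zero hβ y z hyz
    (fun k => (X k : MvPolynomial (Fin (n + 1)) K)) (fun k => by rw [hf]; simp [f])
  have : Algebra.IsIntegral (MvPolynomial (Fin (n + 1)) K) A := by
    refine ⟨fun a => ?_⟩
    obtain ⟨p, rfl⟩ := hgen a
    induction p using MvPolynomial.induction_on with
    | C r =>
      rw [aeval_C, ← f.commutes r, ← hf]
      exact isIntegral_algebraMap
    | add p p' hp hp' => rw [map_add]; exact hp.add hp'
    | mul_X p v hp =>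
      rw [map_mul, aeval_X]
      refine hp.mul ?_
      rcases v with j | k
      · exact (hint j).1
      · exact (hint k).2
  calc ringKrullDim A ≤ ringKrullDim (MvPolynomial (Fin (n + 1)) K) :=
        ringKrullDim_le_of_isIntegral
    _ = ((n + 1 : ℕ) : WithBot ℕ∞) := by simp

theorem algSetDim_V1star_le {β : CoeffIdx n → ℚ} (hβ : eval β (macaulayDet n) ≠ 0) :
    algSetDim (V1star β) ≤ ((n + 1 : ℕ) : WithBot ℕ∞) := by
  let q := Ideal.Quotient.mkₐ ℂ (vanishingIdeal ℂ (V1star β))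
  refine ringKrullDim_le_of_macaulayDet_ne_zero (K := ℂ) hβ (fun j => q (X (Sum.inl j)))
    (fun k => q (X (Sum.inr k))) (fun i => ?_) fun a => ?_
  · have hmem : (∑ j, ∑ k, C (β (i, j, k) : ℂ) * X (Sum.inl j) * X (Sum.inr k)) ∈
        vanishingIdeal ℂ (V1star β) := by
      intro p hp
      have := hp i
      simpa [bilinB''] using this
    have := Ideal.Quotient.eq_zero_iff_mem.2 hmem
    rw [← Ideal.Quotient.mkₐ_eq_mk ℂ] at this
    have hrat : ∀ r : ℚ, q (C (r : ℂ)) = algebraMap ℚ _ r := fun r =>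
      DFunLike.congr_fun (Subsingleton.elim ((q.toRingHom.comp C).comp (algebraMap ℚ ℂ))
        (algebraMap ℚ _)) r
    simp only [← hrat]
    simpa only [map_sum, map_mul] using this
  · obtain ⟨p, rfl⟩ := Ideal.Quotient.mk_surjective a
    refine ⟨p, ?_⟩
    rw [← Ideal.Quotient.mkₐ_eq_mk ℂ]
    refine DFunLike.congr_fun (?_ : _ = q) p
    refine MvPolynomial.algHom_ext fun v => ?_
    rcases v with j | k <;> simp

theorem le_algSetDim_V1star (β : CoeffIdx n → ℚ) :
    ((n + 1 : ℕ) : WithBot ℕ∞) ≤ algSetDim (V1star β) := by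
  -- Restriction of functions to the linear space `y = 0`.
  let g : MvPolynomial (Fin (n + 1) ⊕ Fin (n + 1)) ℂ →ₐ[ℂ] MvPolynomial (Fin (n + 1)) ℂ :=
    aeval (Sum.elim (fun _ => 0) X)
  have hg : ∀ p ∈ vanishingIdeal ℂ (V1star β), g p = 0 := by
    intro p hp
    refine MvPolynomial.funext fun z => ?_
    have h0 : aeval (Sum.elim (fun _ => 0) z : BiAffine n) p = 0 := hp _ fun i => by
      simp [bilinB'']
    rw [map_zero, ← h0, ← MvPolynomial.coe_aeval_eq_eval, RingHom.coe_coe, ← AlgHom.comp_apply]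
    congr 1
    refine MvPolynomial.algHom_ext fun v => ?_
    rcases v with j | k <;> simp [g]
  have hsurj : Function.Surjective (Ideal.Quotient.lift _ g.toRingHom hg) := by
    refine Ideal.Quotient.lift_surjective_of_surjective _ _ fun p => ⟨rename Sum.inr p, ?_⟩
    change g (rename Sum.inr p) = p
    rw [aeval_rename]
    exact aeval_X_left_apply p
  calc ((n + 1 : ℕ) : WithBot ℕ∞) = ringKrullDim (MvPolynomial (Fin (n + 1)) ℂ) := by simp
    _ ≤ algSetDim (V1star β) := ringKrullDim_le_of_surjective _ hsurj

theorem algSetDim_V1star {β : CoeffIdx n → ℚ} (hβ : eval β (macaulayDet n) ≠ 0) :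
    algSetDim (V1star β) = ((n + 1 : ℕ) : WithBot ℕ∞) :=
  le_antisymm (algSetDim_V1star_le hβ) (le_algSetDim_V1star β)

/-- The permutation `(j, i, k) ↦ (i, j, k)` of the indices. -/
def swapIdx (n : ℕ) : CoeffIdx n ≃ CoeffIdx n where
  toFun t := (t.2.1, t.1, t.2.2)
  invFun t := (t.2.1, t.1, t.2.2)

/-- The permutation `(k, i, j) ↦ (i, j, k)` of the indices. -/
def cycleIdx (n : ℕ) : CoeffIdx n ≃ CoeffIdx n where
  toFun t := (t.2.1, t.2.2, t.1)
  invFun t := (t.2.2, t.1, t.2.1)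

theorem V2star_eq (α : CoeffIdx n → ℚ) : V2star α = V1star (α ∘ swapIdx n) := rfl

theorem V3star_eq (α : CoeffIdx n → ℚ) : V3star α = V1star (α ∘ cycleIdx n) := rfl

end Dimension

/-! ### Jacobian criterion by infinitesimal lifting. -/

section Jacobian

theorem aeval_add_of_mul_eq_zero {R σ B : Type*} [CommRing R] [Fintype σ] [CommRing B] [Algebra R B]
    (x ε : σ → B) (hε : ∀ u v, ε u * ε v = 0) (p : MvPolynomial σ R) :
    aeval (x + ε) p = aeval x p + ∑ v, aeval x (pderiv v p) * ε v := by
  classical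
  induction p using MvPolynomial.induction_on with
  | C r => simp
  | add p q hp hq =>
    simp only [map_add, hp, hq, add_mul, Finset.sum_add_distrib]
    ring
  | mul_X p u hp =>
    have h1 : (∑ v, aeval x (pderiv v p) * ε v) * ε u = 0 := by
      simp [Finset.sum_mul, mul_assoc, hε]
    have h2 : ∑ v, aeval x (pderiv v (p * X u)) * ε v =
        aeval x p * ε u + (∑ v, aeval x (pderiv v p) * ε v) * x u := by
      simp only [pderiv_mul, pderiv_X, map_add, map_mul, aeval_X, add_mul, Finset.sum_add_distrib]
      rw [add_comm]
      congr 1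
      · rw [Finset.sum_eq_single u]
        · simp
        · intro v _ hv; simp [hv.symm]
        · simp
      · rw [Finset.sum_mul]
        exact Finset.sum_congr rfl fun v _ => by ring
    rw [map_mul, hp, aeval_X, map_mul, aeval_X, h2, Pi.add_apply]
    linear_combination h1

/-- Jacobian criterion for a hypersurface `f = 0` in the affine space where the coordinates in `T`
are set to `1`. -/
theorem formallySmooth_of_jacobian {R σ : Type*} [CommRing R] [Fintype σ] (f : MvPolynomial σ R)
    (T : Set σ) (I : Ideal (MvPolynomial σ R))
    (hI : I = Ideal.span (insert f ((fun v => X v - 1) '' T)))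
    (b : σ → MvPolynomial σ R) (hbT : ∀ v ∈ T, b v = 0)
    (hb : 1 - ∑ v, b v * pderiv v f ∈ I) :
    Algebra.FormallySmooth R (MvPolynomial σ R ⧸ I) := by
  classical
  refine Algebra.FormallySmooth.of_comp_surjective fun B _ _ J hJ g => ?_
  have hfI : f ∈ I := hI ▸ Ideal.subset_span (Set.mem_insert _ _)
  have hTI : ∀ v ∈ T, X v - 1 ∈ I := fun v hv =>
    hI ▸ Ideal.subset_span (Set.mem_insert_of_mem _ ⟨v, hv, rfl⟩)
  -- Lifting the coordinates in `T` to exactly `1` makes their equations hold in `B`; the correction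
  -- below vanishes on `T` and preserves them.
  have hlift : ∀ v, ∃ x : B, Ideal.Quotient.mk J x = g (Ideal.Quotient.mk I (X v)) ∧
      (v ∈ T → x = 1) := by
    intro v
    by_cases hv : v ∈ T
    · refine ⟨1, ?_, fun _ => rfl⟩
      have : Ideal.Quotient.mk I (X v) = 1 := by
        rw [← map_one (Ideal.Quotient.mk I)]
        exact Ideal.Quotient.eq.2 (hTI v hv)
      rw [this, map_one, map_one]
    · obtain ⟨x, hx⟩ := Ideal.Quotient.mk_surjective (g (Ideal.Quotient.mk I (X v)))
      exact ⟨x, hx, fun h => absurd h hv⟩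
  choose x hx hxT using hlift
  have hφ : ∀ p, Ideal.Quotient.mk J (aeval x p) = g (Ideal.Quotient.mk I p) := by
    have : (Ideal.Quotient.mkₐ R J).comp (aeval x) = g.comp (Ideal.Quotient.mkₐ R I) :=
      MvPolynomial.algHom_ext fun v => by simpa using hx v
    exact fun p => DFunLike.congr_fun this p
  have hφI : ∀ p ∈ I, aeval x p ∈ J := fun p hp => by
    rw [← Ideal.Quotient.eq_zero_iff_mem, hφ, Ideal.Quotient.eq_zero_iff_mem.2 hp, map_zero]
  have hmul : ∀ u ∈ J, ∀ v ∈ J, u * v = 0 := fun u hu v hv => by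
    have := Ideal.mul_mem_mul hu hv
    rwa [← sq, hJ, Ideal.mem_bot] at this
  -- A Newton step: as `J` squares to zero, the new value of `f` is `f(x)` times `1 - ∑ b v * ∂f/∂v`
  -- at `x`, a product of two elements of `J`.
  let ε : σ → B := fun v => -(aeval x (b v) * aeval x f)
  have hεJ : ∀ v, ε v ∈ J := fun v => J.neg_mem (J.mul_mem_left _ (hφI f hfI))
  have hψ := aeval_add_of_mul_eq_zero (R := R) x ε fun u v => hmul _ (hεJ u) _ (hεJ v)
  have hψf : aeval (x + ε) f = 0 := by
    have h := hmul _ (hφI f hfI) _ (hφI _ hb)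
    rw [hψ, ← h, map_sub, map_one, map_sum, mul_sub, mul_one, Finset.mul_sum, sub_eq_add_neg,
      ← Finset.sum_neg_distrib]
    congr 1
    refine Finset.sum_congr rfl fun v _ => ?_
    simp only [ε, map_mul]
    ring
  have hψI : ∀ p ∈ I, aeval (x + ε) p = 0 := by
    have : I ≤ RingHom.ker (aeval (R := R) (x + ε)) := by
      rw [hI, Ideal.span_le]
      rintro _ (rfl | ⟨v, hv, rfl⟩)
      · exact hψf
      · simp [RingHom.mem_ker, ε, hxT v hv, hbT v hv]
    exact fun p hp => this hp
  refine ⟨Ideal.Quotient.liftₐ I (aeval (x + ε)) hψI, ?_⟩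
  refine Ideal.Quotient.algHom_ext _ (MvPolynomial.algHom_ext fun v => ?_)
  change Ideal.Quotient.mk J (aeval (x + ε) (X v)) = g (Ideal.Quotient.mk I (X v))
  rw [aeval_X, Pi.add_apply, map_add, hx, Ideal.Quotient.eq_zero_iff_mem.2 (hεJ v), add_zero]

end Jacobian

/-! ### Generic smoothness on the affine charts. -/

theorem mem_of_sum_mem {ι A S : Type*} [Fintype ι] [AddCommGroup A] [SetLike S A]
    [AddSubgroupClass S A] (G : S) (f : ι → A) (i₀ : ι) (hsum : ∑ i, f i ∈ G)
    (h : ∀ i, i ≠ i₀ → f i ∈ G) : f i₀ ∈ G := by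
  classical
  rw [← Finset.add_sum_erase _ _ (Finset.mem_univ i₀)] at hsum
  exact (add_mem_cancel_right (sum_mem fun i hi => h i (Finset.ne_of_mem_erase hi))).1 hsum

section Chart

variable {n : ℕ}

/-- The coefficient index reached from `(a, b, c)` by replacing the entry named by a coordinate. -/
def neighbour (a b c : Fin (n + 1)) : CoordIdx n → CoeffIdx n
  | Sum.inl i => (i, b, c)
  | Sum.inr (Sum.inl j) => (a, j, c)
  | Sum.inr (Sum.inr k) => (a, b, k)

/-- The coordinates set to `1` in a chart. -/
def chartCoords (a b c : Fin (n + 1)) : Set (CoordIdx n) :=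
  {Sum.inl a, Sum.inr (Sum.inl b), Sum.inr (Sum.inr c)}

/-- The singularity equations are triangular in the neighbouring coefficients. Each partial
derivative contains exactly one of them, with multiplier `1`; once these are known, `F` itself
determines the coefficient at `(a, b, c)`. -/
theorem coeff_mem_of_trilinear {A : Type*} [CommRing A] [Algebra ℚ A] (G : Subalgebra ℚ A)
    (α : CoeffIdx n → A) (x y z : Fin (n + 1) → A) {a b c : Fin (n + 1)}
    (hxa : x a = 1) (hyb : y b = 1) (hzc : z c = 1)
    (hx : ∀ i, x i ∈ G) (hy : ∀ j, y j ∈ G) (hz : ∀ k, z k ∈ G)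
    (hα : ∀ t ∉ Set.range (neighbour a b c), α t ∈ G)
    (hF : ∑ i, ∑ j, ∑ k, α (i, j, k) * x i * y j * z k = 0)
    (hFx : ∀ i ≠ a, ∑ j, ∑ k, α (i, j, k) * y j * z k = 0)
    (hFy : ∀ j ≠ b, ∑ i, ∑ k, α (i, j, k) * x i * z k = 0)
    (hFz : ∀ k ≠ c, ∑ i, ∑ j, α (i, j, k) * x i * y j = 0) (t : CoeffIdx n) : α t ∈ G := by
  have h1 : ∀ i ≠ a, α (i, b, c) ∈ G := by
    intro i hi
    have := mem_of_sum_mem G (fun s : Fin (n + 1) × Fin (n + 1) => α (i, s.1, s.2) * y s.1 * z s.2)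
      (b, c) (by rw [Fintype.sum_prod_type, hFx i hi]; exact G.zero_mem) fun s hs =>
        G.mul_mem (G.mul_mem (hα _ ?_) (hy _)) (hz _)
    · simpa [hyb, hzc] using this
    · rintro ⟨_ | _ | _, h⟩ <;> simp_all [neighbour, Prod.ext_iff]
  have h2 : ∀ j ≠ b, α (a, j, c) ∈ G := by
    intro j hj
    have := mem_of_sum_mem G (fun s : Fin (n + 1) × Fin (n + 1) => α (s.1, j, s.2) * x s.1 * z s.2)
      (a, c) (by rw [Fintype.sum_prod_type, hFy j hj]; exact G.zero_mem) fun s hs =>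
        G.mul_mem (G.mul_mem (hα _ ?_) (hx _)) (hz _)
    · simpa [hxa, hzc] using this
    · rintro ⟨_ | _ | _, h⟩ <;> simp_all [neighbour, Prod.ext_iff]
  have h3 : ∀ k ≠ c, α (a, b, k) ∈ G := by
    intro k hk
    have := mem_of_sum_mem G (fun s : Fin (n + 1) × Fin (n + 1) => α (s.1, s.2, k) * x s.1 * y s.2)
      (a, b) (by rw [Fintype.sum_prod_type, hFz k hk]; exact G.zero_mem) fun s hs =>
        G.mul_mem (G.mul_mem (hα _ ?_) (hx _)) (hy _)
    · simpa [hxa, hyb] using this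
    · rintro ⟨_ | _ | _, h⟩ <;> simp_all [neighbour, Prod.ext_iff]
  have h4 : ∀ t ≠ (a, b, c), α t ∈ G := by
    intro t ht
    by_cases h : t ∈ Set.range (neighbour a b c)
    · obtain ⟨i | j | k, rfl⟩ := h
      · exact h1 i fun h => ht (by rw [h]; rfl)
      · exact h2 j fun h => ht (by rw [h]; rfl)
      · exact h3 k fun h => ht (by rw [h]; rfl)
    · exact hα t h
  by_cases ht : t = (a, b, c)
  · have := mem_of_sum_mem G (fun s : CoeffIdx n => α s * x s.1 * y s.2.1 * z s.2.2)
      (a, b, c) (by simp only [Fintype.sum_prod_type, hF]; exact G.zero_mem) fun s hs =>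
        G.mul_mem (G.mul_mem (G.mul_mem (h4 s hs) (hx _)) (hy _)) (hz _)
    rw [ht]
    simpa [hxa, hyb, hzc] using this
  · exact h4 t ht

theorem card_chart_generators_lt (a b c : Fin (n + 1)) :
    Nat.card ({v // v ∉ chartCoords a b c} ⊕ {t // t ∉ Set.range (neighbour a b c)}) <
      Nat.card (CoeffIdx n) := by
  classical
  -- `none` goes to `(a, b, c)`, which no free coordinate reaches; this extra element makes the
  -- inequality strict.
  let τ : Option {v // v ∉ chartCoords a b c} → Set.range (neighbour a b c) :=
    fun v => v.elim ⟨_, Set.mem_range_self (Sum.inl a)⟩ fun v => ⟨_, Set.mem_range_self v.1⟩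
  have hne : ∀ v ∉ chartCoords a b c, neighbour a b c v ≠ (a, b, c) := by
    rintro (i | j | k) hv <;> simpa [chartCoords, neighbour] using hv
  have hinj : ∀ v ∉ chartCoords a b c, ∀ v' ∉ chartCoords a b c,
      neighbour a b c v = neighbour a b c v' → v = v' := by
    rintro (i | j | k) hv (i' | j' | k') hv' h <;>
      simp [chartCoords, neighbour] at hv hv' h ⊢ <;> tauto
  have hτ : Function.Injective τ := by
    rintro (_ | ⟨v, hv⟩) (_ | ⟨v', hv'⟩) h
    · rfl
    · exact absurd (congrArg Subtype.val h).symm (hne v' hv')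
    · exact absurd (congrArg Subtype.val h) (hne v hv)
    · exact congrArg some (Subtype.ext (hinj v hv v' hv' (congrArg Subtype.val h)))
  have h1 := Nat.card_le_card_of_injective τ hτ
  rw [Finite.card_option] at h1
  have h2 := Nat.card_congr (Equiv.Set.sumCompl (Set.range (neighbour a b c)))
  rw [Nat.card_sum] at h2 ⊢
  have h3 : Nat.card {t // t ∉ Set.range (neighbour a b c)} =
    Nat.card ((Set.range (neighbour a b c))ᶜ : Set (CoeffIdx n)) := rfl
  omega

theorem pderiv_trilinearForm_inl (α : CoeffIdx n → ℚ) (i : Fin (n + 1)) :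
    pderiv (Sum.inl i) (trilinearForm α) = ∑ j, ∑ k, C (α (i, j, k)) * coordY j * coordZ k := by
  simp only [trilinearForm, map_sum]
  rw [Finset.sum_eq_single i]
  · simp [coordX, coordY, coordZ, pderiv_X]
    exact Finset.sum_congr rfl fun j _ => Finset.sum_congr rfl fun k _ => by ring
  · intro i' _ hi
    simp [coordX, coordY, coordZ, pderiv_X, hi]
  · simp

theorem pderiv_trilinearForm_inr_inl (α : CoeffIdx n → ℚ) (j : Fin (n + 1)) :
    pderiv (Sum.inr (Sum.inl j)) (trilinearForm α) =
      ∑ i, ∑ k, C (α (i, j, k)) * coordX i * coordZ k := by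
  simp only [trilinearForm, map_sum]
  refine Finset.sum_congr rfl fun i _ => ?_
  rw [Finset.sum_eq_single j]
  · simp [coordX, coordY, coordZ, pderiv_X]
    exact Finset.sum_congr rfl fun k _ => by ring
  · intro j' _ hj
    simp [coordX, coordY, coordZ, pderiv_X, hj]
  · simp

theorem pderiv_trilinearForm_inr_inr (α : CoeffIdx n → ℚ) (k : Fin (n + 1)) :
    pderiv (Sum.inr (Sum.inr k)) (trilinearForm α) =
      ∑ i, ∑ j, C (α (i, j, k)) * coordX i * coordY j := by
  simp only [trilinearForm, map_sum]
  refine Finset.sum_congr rfl fun i _ => Finset.sum_congr rfl fun j _ => ?_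
  rw [Finset.sum_eq_single k]
  · simp [coordX, coordY, coordZ, pderiv_X]
  · intro k' _ hk
    simp [coordX, coordY, coordZ, pderiv_X, hk]
  · simp

open scoped Classical in
/-- The ideal of the singular locus of the chart `x a = y b = z c = 1` of `V`. -/
noncomputable def singularIdeal (α : CoeffIdx n → ℚ) (a b c : Fin (n + 1)) :
    Ideal (MvPolynomial (CoordIdx n) ℚ) :=
  chartIdeal α a b c ⊔ Ideal.span (Set.range fun v =>
    if v ∈ chartCoords a b c then 0 else pderiv v (trilinearForm α))

/-- Specialization of the coefficients in the universal family. -/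
noncomputable def specializeCoeff (α : CoeffIdx n → ℚ) :
    MvPolynomial (CoeffIdx n ⊕ CoordIdx n) ℚ →ₐ[ℚ] MvPolynomial (CoordIdx n) ℚ :=
  aeval (Sum.elim (fun t => C (α t)) X)

/-- The polynomials whose specializations vanish on the singular locus of the chart. -/
noncomputable def universalSingularIdeal (a b c : Fin (n + 1)) :
    Ideal (MvPolynomial (CoeffIdx n ⊕ CoordIdx n) ℚ) :=
  ⨅ α : CoeffIdx n → ℚ, (singularIdeal α a b c).comap (specializeCoeff α)

theorem pderiv_mem_singularIdeal (α : CoeffIdx n → ℚ) {a b c : Fin (n + 1)} {v : CoordIdx n}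
    (hv : v ∉ chartCoords a b c) : pderiv v (trilinearForm α) ∈ singularIdeal α a b c :=
  Ideal.mem_sup_right (Ideal.subset_span ⟨v, if_neg hv⟩)

theorem exists_relation_universalSingularIdeal (a b c : Fin (n + 1)) :
    ∃ P : MvPolynomial (CoeffIdx n) ℚ, P ≠ 0 ∧
      rename Sum.inl P ∈ universalSingularIdeal a b c := by
  let q := Ideal.Quotient.mkₐ ℚ (universalSingularIdeal a b c)
  -- Relations in the universal quotient can be checked at each rational coefficient tuple.
  have hq : ∀ p, (∀ α, specializeCoeff α p ∈ singularIdeal α a b c) → q p = 0 := fun p hp =>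
    Ideal.Quotient.eq_zero_iff_mem.2 (Ideal.mem_iInf.2 hp)
  let α : CoeffIdx n → _ := fun t => q (X (Sum.inl t))
  let w : CoordIdx n → _ := fun v => q (X (Sum.inr v))
  have hone : ∀ v ∈ chartCoords a b c, w v = 1 := by
    intro v hv
    rw [← sub_eq_zero, ← map_one q, ← map_sub]
    refine hq _ fun β => Ideal.mem_sup_left (Ideal.subset_span ?_)
    rcases hv with rfl | rfl | rfl <;> simp [specializeCoeff, coordX, coordY, coordZ]
  let g : {v // v ∉ chartCoords a b c} ⊕ {t // t ∉ Set.range (neighbour a b c)} →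
      MvPolynomial (CoeffIdx n ⊕ CoordIdx n) ℚ ⧸ universalSingularIdeal a b c :=
    Sum.elim (fun v => w v) fun t => α t
  have hw : ∀ v, w v ∈ (aeval g : _ →ₐ[ℚ] _).range := by
    intro v
    by_cases hv : v ∈ chartCoords a b c
    · rw [hone v hv]; exact one_mem _
    · exact ⟨X (Sum.inl ⟨v, hv⟩), by simp [g]⟩
  have hα : ∀ t, α t ∈ (aeval g : _ →ₐ[ℚ] _).range := by
    refine coeff_mem_of_trilinear _ α (fun i => w (Sum.inl i)) (fun j => w (Sum.inr (Sum.inl j)))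
      (fun k => w (Sum.inr (Sum.inr k))) (hone _ (by simp [chartCoords]))
      (hone _ (by simp [chartCoords])) (hone _ (by simp [chartCoords]))
      (fun _ => hw _) (fun _ => hw _) (fun _ => hw _)
      (fun t ht => ⟨X (Sum.inr ⟨t, ht⟩), by simp [g]⟩) ?_ ?_ ?_ ?_
    · simp only [α, w, ← map_mul, ← map_sum]
      refine hq _ fun β => Ideal.mem_sup_left (Ideal.subset_span (Or.inl ?_))
      simp [specializeCoeff, trilinearForm, coordX, coordY, coordZ]
    · intro i hi
      simp only [α, w, ← map_mul, ← map_sum]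
      refine hq _ fun β => ?_
      have := pderiv_mem_singularIdeal β (a := a) (b := b) (c := c) (v := Sum.inl i)
        (by simpa [chartCoords] using hi)
      rw [pderiv_trilinearForm_inl] at this
      simpa [specializeCoeff, coordX, coordY, coordZ] using this
    · intro j hj
      simp only [α, w, ← map_mul, ← map_sum]
      refine hq _ fun β => ?_
      have := pderiv_mem_singularIdeal β (a := a) (b := b) (c := c) (v := Sum.inr (Sum.inl j))
        (by simpa [chartCoords] using hj)
      rw [pderiv_trilinearForm_inr_inl] at this
      simpa [specializeCoeff, coordX, coordY, coordZ] using this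
    · intro k hk
      simp only [α, w, ← map_mul, ← map_sum]
      refine hq _ fun β => ?_
      have := pderiv_mem_singularIdeal β (a := a) (b := b) (c := c) (v := Sum.inr (Sum.inr k))
        (by simpa [chartCoords] using hk)
      rw [pderiv_trilinearForm_inr_inr] at this
      simpa [specializeCoeff, coordX, coordY, coordZ] using this
  have hsurj : Function.Surjective (aeval (R := ℚ) g) := by
    rw [← AlgHom.range_eq_top, eq_top_iff]
    rintro r -
    obtain ⟨p, rfl⟩ := Ideal.Quotient.mk_surjective r
    have : q p = aeval (Sum.elim α w) p :=
      DFunLike.congr_fun (f := q) (MvPolynomial.algHom_ext fun v => by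
        rcases v with t | v <;> simp only [aeval_X, Sum.elim_inl, Sum.elim_inr, α, w]) p
    change q p ∈ _
    rw [this]
    refine (?_ : (aeval (R := ℚ) (Sum.elim α w)).range ≤ _) ⟨p, rfl⟩
    rw [← Algebra.adjoin_range_eq_range_aeval, Algebra.adjoin_le_iff]
    rintro _ ⟨t | v, rfl⟩
    · exact hα t
    · exact hw v
  -- Independence would force the transcendence degree to be at least the number of coefficients,
  -- exceeding the number of generators.
  have hdep : ¬ AlgebraicIndependent ℚ α := by
    intro hind
    have h1 := hind.cardinalMk_le_trdeg.trans (trdeg_le_of_surjective _ hsurj)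
    rw [MvPolynomial.trdeg_of_isDomain, Cardinal.lift_id, ← Nat.cast_card, ← Nat.cast_card,
      Nat.cast_le] at h1
    exact h1.not_gt (card_chart_generators_lt a b c)
  rw [algebraicIndependent_iff] at hdep
  push Not at hdep
  obtain ⟨P, hP, hP0⟩ := hdep
  refine ⟨P, hP0, Ideal.Quotient.eq_zero_iff_mem.1 ?_⟩
  change q (rename Sum.inl P) = 0
  rw [← hP]
  refine DFunLike.congr_fun (f := q.comp (rename Sum.inl)) (MvPolynomial.algHom_ext fun t => ?_) P
  simp [α]

theorem smooth_chartRing_of_one_mem {α : CoeffIdx n → ℚ} {a b c : Fin (n + 1)}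
    (h : 1 ∈ singularIdeal α a b c) : Algebra.Smooth ℚ (ChartRing α a b c) := by
  classical
  have hfp : Algebra.FinitePresentation ℚ (ChartRing α a b c) :=
    Algebra.FinitePresentation.quotient (Submodule.fg_span (Set.toFinite _))
  obtain ⟨u, hu, v, hv, huv⟩ := Submodule.mem_sup.1 h
  obtain ⟨d, rfl⟩ := Ideal.mem_span_range_iff_exists_fun.1 hv
  have hfs : Algebra.FormallySmooth ℚ (ChartRing α a b c) := by
    refine formallySmooth_of_jacobian (trilinearForm α) (chartCoords a b c) _ ?_
      (fun v => if v ∈ chartCoords a b c then 0 else d v) (fun v hv => if_pos hv) ?_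
    · simp [chartIdeal, chartCoords, Set.image_insert_eq, coordX, coordY, coordZ]
    · convert hu using 1
      rw [← huv, add_sub_assoc, ← Finset.sum_sub_distrib, Finset.sum_eq_zero, add_zero]
      intro v _
      split_ifs <;> simp
  exact ⟨hfs, hfp⟩

/-- Specializing the universal relation puts the constant `P(α)` in the singular ideal; when nonzero
it is a unit. -/
theorem exists_chart_discriminant (a b c : Fin (n + 1)) :
    ∃ P : MvPolynomial (CoeffIdx n) ℚ, P ≠ 0 ∧
      ∀ α : CoeffIdx n → ℚ, eval α P ≠ 0 → Algebra.Smooth ℚ (ChartRing α a b c) := by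
  obtain ⟨P, hP0, hP⟩ := exists_relation_universalSingularIdeal a b c
  refine ⟨P, hP0, fun α hα => smooth_chartRing_of_one_mem ?_⟩
  have h : specializeCoeff α (rename Sum.inl P) ∈ singularIdeal α a b c := Ideal.mem_iInf.1 hP α
  have hC : specializeCoeff α (rename Sum.inl P) = C (eval α P) := by
    rw [specializeCoeff, aeval_rename]
    exact (MvPolynomial.aeval_algebraMap_apply _ α P).trans (by simp [aeval_eq_eval])
  rw [hC] at h
  have := Ideal.mul_mem_left _ (C (eval α P)⁻¹) h
  rwa [← C_mul, inv_mul_cancel₀ hα, C_1] at this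

end Chart

/-! ### The open set of good coefficients. -/

theorem mainTheorem9 (n : ℕ) :
    ∃ U : Set (PrimeSpectrum (MvPolynomial (CoeffIdx n) ℚ)),
      IsOpen U ∧ Dense U ∧
      ∀ α : CoeffIdx n → ℚ, pointToPoint α ∈ U →
        IsSmoothHypersurface α ∧
        algSetDim (V1star α) = ((n + 1 : ℕ) : WithBot ℕ∞) ∧
        algSetDim (V2star α) = ((n + 1 : ℕ) : WithBot ℕ∞) ∧
        algSetDim (V3star α) = ((n + 1 : ℕ) : WithBot ℕ∞) := by
  choose P hP0 hP using fun t : CoeffIdx n => exists_chart_discriminant t.1 t.2.1 t.2.2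
  let Q : MvPolynomial (CoeffIdx n) ℚ := (∏ t, P t) * (macaulayDet n *
    (rename (swapIdx n) (macaulayDet n) * rename (cycleIdx n) (macaulayDet n)))
  have hren : ∀ e : CoeffIdx n ≃ CoeffIdx n, rename e (macaulayDet n) ≠ 0 := fun e h =>
    macaulayDet_ne_zero n (rename_injective e e.injective (h.trans (map_zero _).symm))
  have hQ : Q ≠ 0 := mul_ne_zero (Finset.prod_ne_zero_iff.2 fun t _ => hP0 t)
    (mul_ne_zero (macaulayDet_ne_zero n) (mul_ne_zero (hren _) (hren _)))
  -- The spectrum is irreducible, so density only needs a point: the zero ideal, which does not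
  -- contain `Q`.
  refine ⟨PrimeSpectrum.basicOpen Q, PrimeSpectrum.isOpen_basicOpen,
    PrimeSpectrum.isOpen_basicOpen.dense ⟨⟨⊥, Ideal.isPrime_bot⟩, hQ⟩, fun α hα => ?_⟩
  have hα' : eval α Q ≠ 0 := by
    intro h
    refine hα ((mem_vanishingIdeal_singleton_iff α Q).2 ?_)
    rw [aeval_eq_eval]
    exact h
  simp only [Q, map_mul, map_prod, eval_rename, ne_eq, mul_eq_zero, not_or,
    Finset.prod_eq_zero_iff, not_exists, not_and] at hα'
  obtain ⟨hs, h1, h2, h3⟩ := hα'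
  exact ⟨fun a b c => hP (a, b, c) α (hs _ (Finset.mem_univ _)), algSetDim_V1star h1,
    V2star_eq α ▸ algSetDim_V1star h2, V3star_eq α ▸ algSetDim_V1star h3⟩
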